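/- **Conventions.** A *variety* of semigroups is the class of all semigroups satisfying some (arbitrary, possibly infinite) set of semigroup identities; in particular, no bound on the number of letters in the identities (axiomatic rank) is assumed. A semigroup is *periodic* if each of its one-generated subsemigroups is finite, and *completely regular* if it is a union of groups. For a semigroup $S$ and $x\in S$ put $xS^1=\{x\}\cup xS$ and $S^1x=\{x\}\cup Sx$. Green's relations on $S$ are given by $x\,\mathscr R\,y\Leftrightarrow xS^1=yS^1$, $x\,\mathscr L\,y\Leftrightarrow S^1x=S^1y$, and $\mathscr H=\mathscr R\cap\mathscr L$. For $\mathscr K\in\{\mathscr R,\mathscr L,\mathscr H\}$, a variety $\mathbf V$ is *locally $\mathscr K$-finite* if every finitely generated semigroup in $\mathbf V$ has only finitely many $\mathscr K$-classes. A *Novikov–Adian group* is an infinite finitely generated group of finite exponent. For a group $G$ with trivial subgroup $E=\{1\}$, $L(G)$ is the disjoint union of $G$ and the set $\{gE\mid g\in G\}$ of left cosets of $E$ (with $gE$ regarded as different from $g$), whose multiplication extends that of $G$ by $$g_1(g_2E)=g_1g_2E,\qquad (g_1E)g_2=(g_1E)(g_2E)=g_1E .$$ Dually, $R(G)$ is the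 disjoint union of $G$ and the set $\{Eg\mid g\in G\}$ of right cosets of $E$, whose multiplication extends that of $G$ by $$(Eg_1)g_2=Eg_1g_2,\qquad g_1(Eg_2)=(Eg_1)(Eg_2)=Eg_2 .$$ **Theorem.** Let $\mathbf V$ be a variety of periodic completely regular semigroups. (r) $\mathbf V$ is locally $\mathscr R$-finite if and only if $\mathbf V$ contains none of the semigroups $L(G)$ where $G$ is a Novikov–Adian group. ($\ell$) $\mathbf V$ is locally $\mathscr L$-finite if and only if $\mathbf V$ contains none of the semigroups $R(G)$ where $G$ is a Novikov–Adian group. (h) $\mathbf V$ is locally $\mathscr H$-finite if and only if $\mathbf V$ contains none of the semigroups $L(G)$, $R(G)$ where $G$ is a Novikov–Adian group. -/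

import Mathlib

universe u

/-! ### Varieties of semigroups -/

/-- The semigroup `S` satisfies the identity `u = v`, where `u`, `v` are semigroup words in the
countable alphabet `ℕ`. -/
def SatisfiesIdentity (S : Type*) [Semigroup S] (u v : FreeSemigroup ℕ) : Prop :=
  ∀ a : ℕ → S, FreeSemigroup.lift a u = FreeSemigroup.lift a v

/-- A class of semigroups is a variety if it consists of all semigroups satisfying some
(arbitrary, possibly infinite) set of identities. -/
def IsSemigroupVariety (V : (S : Type u) → [Semigroup S] → Prop) : Prop :=
  ∃ E : Set (FreeSemigroup ℕ × FreeSemigroup ℕ),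
    ∀ (S : Type u) [Semigroup S], V S ↔ ∀ p ∈ E, SatisfiesIdentity S p.1 p.2

/-! ### Properties of semigroups -/

/-- Every monogenic subsemigroup of `S` is finite. -/
def IsPeriodicSemigroup (S : Type*) [Semigroup S] : Prop :=
  ∀ x : S, (Subsemigroup.closure {x} : Set S).Finite

/-- The subsemigroup `T` is a group under the multiplication of `S`
(its identity element need not be an identity element of `S`). -/
def Subsemigroup.IsGroup {S : Type*} [Semigroup S] (T : Subsemigroup S) : Prop :=
  ∃ e ∈ T, (∀ t ∈ T, e * t = t ∧ t * e = t) ∧ ∀ t ∈ T, ∃ u ∈ T, t * u = e ∧ u * t = e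

/-- `S` is a union of groups. -/
def IsCompletelyRegular (S : Type*) [Semigroup S] : Prop :=
  ∀ x : S, ∃ T : Subsemigroup S, T.IsGroup ∧ x ∈ T

/-- `S` is generated by a finite subset as a semigroup. -/
def IsFGSemigroup (S : Type*) [Semigroup S] : Prop :=
  ∃ X : Set S, X.Finite ∧ Subsemigroup.closure X = ⊤

/-! ### Green's relations -/

/-- The right ideal `x S¹ = {x} ∪ x S`. -/
def principalRightIdeal {S : Type*} [Semigroup S] (x : S) : Set S :=
  insert x (Set.range fun s => x * s)

/-- The left ideal `S¹ x = {x} ∪ S x`. -/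
def principalLeftIdeal {S : Type*} [Semigroup S] (x : S) : Set S :=
  insert x (Set.range fun s => s * x)

/-- Green's relation R: `x S¹ = y S¹`. -/
def greenR (S : Type*) [Semigroup S] : Setoid S :=
  Setoid.ker principalRightIdeal

/-- Green's relation L: `S¹ x = S¹ y`. -/
def greenL (S : Type*) [Semigroup S] : Setoid S :=
  Setoid.ker principalLeftIdeal

/-- Green's relation H, the intersection of R and L. -/
def greenH (S : Type*) [Semigroup S] : Setoid S :=
  greenR S ⊓ greenL S

/-- Every finitely generated semigroup in `V` has only finitely many R-classes. -/
def IsLocallyRFinite (V : (S : Type u) → [Semigroup S] → Prop) : Prop :=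
  ∀ (S : Type u) [Semigroup S], V S → IsFGSemigroup S → Finite (Quotient (greenR S))

/-- Every finitely generated semigroup in `V` has only finitely many L-classes. -/
def IsLocallyLFinite (V : (S : Type u) → [Semigroup S] → Prop) : Prop :=
  ∀ (S : Type u) [Semigroup S], V S → IsFGSemigroup S → Finite (Quotient (greenL S))

/-- Every finitely generated semigroup in `V` has only finitely many H-classes. -/
def IsLocallyHFinite (V : (S : Type u) → [Semigroup S] → Prop) : Prop :=
  ∀ (S : Type u) [Semigroup S], V S → IsFGSemigroup S → Finite (Quotient (greenH S))

/-! ### Novikov–Adian groups and the forbidden semigroups -/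

/-- An infinite finitely generated group of finite exponent. -/
def IsNovikovAdian (G : Type*) [Group G] : Prop :=
  Infinite G ∧ Group.FG G ∧ Monoid.ExponentExists G

/-- The disjoint union of `G` and the set of left cosets `gH`. -/
inductive LeftCosetSemigroup {G : Type*} [Group G] (H : Subgroup G)
  | elt (g : G) : LeftCosetSemigroup H
  | coset (c : G ⧸ H) : LeftCosetSemigroup H

/-- The multiplication of `G`, together with `g₁ (g₂H) = g₁g₂H` and
`(g₁H) g₂ = (g₁H)(g₂H) = g₁H`. -/
def LeftCosetSemigroup.mul {G : Type*} [Group G] {H : Subgroup G} :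
    LeftCosetSemigroup H → LeftCosetSemigroup H → LeftCosetSemigroup H
  | .elt g₁, .elt g₂ => .elt (g₁ * g₂)
  | .elt g, .coset c => .coset (g • c)
  | .coset c, _ => .coset c

instance LeftCosetSemigroup.instSemigroup {G : Type*} [Group G] (H : Subgroup G) :
    Semigroup (LeftCosetSemigroup H) where
  mul := LeftCosetSemigroup.mul
  mul_assoc := by
    rintro (a | a) (b | b) (c | c)
    · exact congrArg LeftCosetSemigroup.elt (mul_assoc a b c)
    · exact congrArg LeftCosetSemigroup.coset (mul_smul a b c)
    all_goals rfl

/-- Right cosets of `H` in `G`. -/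
abbrev RightCosets {G : Type*} [Group G] (H : Subgroup G) : Type _ :=
  Quotient (QuotientGroup.rightRel H)

/-- Right translation `(Hg₁) g₂ = Hg₁g₂` of right cosets. -/
def RightCosets.translate {G : Type*} [Group G] {H : Subgroup G}
    (c : RightCosets H) (g : G) : RightCosets H :=
  Quotient.map (fun x => x * g) (fun x y h => by
    have h' := QuotientGroup.rightRel_apply.mp h
    exact QuotientGroup.rightRel_apply.mpr (by simpa [mul_assoc] using h')) c

/-- The disjoint union of `G` and the set of right cosets `Hg`. -/
inductive RightCosetSemigroup {G : Type*} [Group G] (H : Subgroup G)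
  | elt (g : G) : RightCosetSemigroup H
  | coset (c : RightCosets H) : RightCosetSemigroup H

/-- The multiplication of `G`, together with `(Hg₁) g₂ = Hg₁g₂` and
`g₁ (Hg₂) = (Hg₁)(Hg₂) = Hg₂`. -/
def RightCosetSemigroup.mul {G : Type*} [Group G] {H : Subgroup G} :
    RightCosetSemigroup H → RightCosetSemigroup H → RightCosetSemigroup H
  | .elt g₁, .elt g₂ => .elt (g₁ * g₂)
  | .coset c, .elt g => .coset (c.translate g)
  | _, .coset c => .coset c

instance RightCosetSemigroup.instSemigroup {G : Type*} [Group G] (H : Subgroup G) :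
    Semigroup (RightCosetSemigroup H) where
  mul := RightCosetSemigroup.mul
  mul_assoc := by
    rintro (a | a) (b | b) (c | c)
    · exact congrArg RightCosetSemigroup.elt (mul_assoc a b c)
    · rfl
    · rfl
    · rfl
    · induction a using Quotient.inductionOn with
      | h a =>
        exact congrArg (fun x => RightCosetSemigroup.coset (Quotient.mk _ x)) (mul_assoc a b c)
    all_goals rfl

/-- `L(G)`: the case of the trivial subgroup. -/
abbrev LSemigroup (G : Type*) [Group G] : Type _ :=
  LeftCosetSemigroup (⊥ : Subgroup G)

/-- `R(G)`: the case of the trivial subgroup. -/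
abbrev RSemigroup (G : Type*) [Group G] : Type _ :=
  RightCosetSemigroup (⊥ : Subgroup G)

/-!
Let `S` be a finitely generated completely regular semigroup. Its J-classes are the values of a
homomorphism `k` from `S` to a semilattice, finite because `S` is finitely generated, and
multiplying an element on the right by an element whose J-class is not lower does not change its
R-class (`IsCompletelyRegular.exists_finite_grading`).

Suppose that, for every idempotent `e` and every finitely generated subgroup `G` of the H-class of
`e`, the group `G` has finite orbits on the R-classes of `S`. Then `S` has finitely many R-classes.
Indeed, going down the J-classes, an element of the J-class `d` has the R-class of a generator or of
a product `q * x`, where `x` is a generator and `q` lies strictly above `d`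
(`IsCompletelySimpleGrading.exists_prefix`). Write `q = s * p`, where `p` is a shortest suffix of `q`
in the J-class of `q`. A second induction shows that finitely many pairs of R-classes, of `p` and
of `p * x`, occur; since R is a left congruence, finitely many `p` suffice. For fixed `p` the
elements `s * p` run through an L-class, which is the product of a finite set with a finitely
generated group, because by the first induction its J-class has finitely many R-classes
(`IsCompletelySimpleGrading.exists_schreier_generators`). So the hypothesis on orbits applies.

If, on the other hand, some orbit `G x` meets infinitely many R-classes, let `Q` be the quotient of
`G` that acts faithfully on them. Then `Q` is infinite and finitely generated, and `L(Q)` satisfies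
all identities of `S`: the R-classes of the orbit multiply as left zeros, and faithfulness turns the
cosets of a point stabilizer, taken for all points of the orbit together, into cosets of the trivial
subgroup (`satisfiesIdentity_LSemigroup_of_orbit_infinite`). Periodicity of the powers of `L(Q)`
bounds the exponent of `Q` (`exponentExists_of_LSemigroup`), so `Q` is a Novikov–Adian group.

Conversely `L(G)` is finitely generated when `G` is, and each of its left cosets is an R-class. The
result for L follows by passing to opposite semigroups, and a semigroup has finitely many H-classes
if and only if it has finitely many R-classes and finitely many L-classes.
-/

/-! ### Green's relation R in completely regular semigroups -/

section RightIdeals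

variable {S : Type*} [Semigroup S]

lemma principalRightIdeal_mul (s x : S) :
    principalRightIdeal (s * x) = (fun y => s * y) '' principalRightIdeal x := by
  simp only [principalRightIdeal, Set.image_insert_eq, ← Set.range_comp]
  congr 2
  funext t
  exact mul_assoc s x t

/-- Green's relation R is a left congruence. -/
lemma principalRightIdeal_mul_congr (s : S) {x y : S}
    (h : principalRightIdeal x = principalRightIdeal y) :
    principalRightIdeal (s * x) = principalRightIdeal (s * y) := by
  rw [principalRightIdeal_mul, principalRightIdeal_mul, h]

lemma principalRightIdeal_mul_eq_self {x s u : S} (h : x * s * u = x) :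
    principalRightIdeal (x * s) = principalRightIdeal x := by
  ext z
  simp only [principalRightIdeal, Set.mem_insert_iff, Set.mem_range]
  constructor
  · rintro (rfl | ⟨t, rfl⟩)
    · exact Or.inr ⟨s, rfl⟩
    · exact Or.inr ⟨s * t, (mul_assoc x s t).symm⟩
  · rintro (rfl | ⟨t, rfl⟩)
    · exact Or.inr ⟨u, h⟩
    · exact Or.inr ⟨u * t, by rw [← mul_assoc, h]⟩

/-- `A` meets only finitely many R-classes. -/
def MeetsFinitelyManyRClasses (A : Set S) : Prop :=
  (principalRightIdeal '' A).Finite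

lemma finite_quotient_greenR_iff :
    Finite (Quotient (greenR S)) ↔ MeetsFinitelyManyRClasses (Set.univ : Set S) := by
  rw [MeetsFinitelyManyRClasses, Set.image_univ, ← Set.finite_coe_iff]
  exact (Setoid.quotientKerEquivRange principalRightIdeal).finite_iff

namespace MeetsFinitelyManyRClasses

variable {A B : Set S}

lemma mono (hB : MeetsFinitelyManyRClasses B) (h : A ⊆ B) : MeetsFinitelyManyRClasses A :=
  hB.subset (Set.image_mono h)

lemma of_finite (hA : A.Finite) : MeetsFinitelyManyRClasses A := hA.image _

/-- Only the R-classes met matter: `A` may be replaced by a set with the same R-classes. -/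
lemma of_forall_exists (hB : MeetsFinitelyManyRClasses B)
    (h : ∀ a ∈ A, ∃ b ∈ B, principalRightIdeal a = principalRightIdeal b) :
    MeetsFinitelyManyRClasses A := by
  refine hB.subset ?_
  rintro _ ⟨a, ha, rfl⟩
  obtain ⟨b, hb, hab⟩ := h a ha
  exact ⟨b, hb, hab.symm⟩

lemma biUnion {ι : Type*} {T : Set ι} (hT : T.Finite) {f : ι → Set S}
    (h : ∀ i ∈ T, MeetsFinitelyManyRClasses (f i)) :
    MeetsFinitelyManyRClasses (⋃ i ∈ T, f i) := by
  rw [MeetsFinitelyManyRClasses, Set.image_iUnion₂]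
  exact hT.biUnion h

lemma union (hA : MeetsFinitelyManyRClasses A) (hB : MeetsFinitelyManyRClasses B) :
    MeetsFinitelyManyRClasses (A ∪ B) := by
  rw [MeetsFinitelyManyRClasses, Set.image_union]
  exact Set.Finite.union hA hB

lemma mul_left (hA : MeetsFinitelyManyRClasses A) (s : S) :
    MeetsFinitelyManyRClasses ((fun a => s * a) '' A) := by
  refine (Set.Finite.image (fun I => (fun y => s * y) '' I) hA).subset ?_
  rintro _ ⟨_, ⟨a, ha, rfl⟩, rfl⟩
  exact ⟨_, ⟨a, ha, rfl⟩, (principalRightIdeal_mul s a).symm⟩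

lemma exists_representatives (hA : MeetsFinitelyManyRClasses A) :
    ∃ F ⊆ A, F.Finite ∧ ∀ a ∈ A, ∃ r ∈ F, principalRightIdeal r = principalRightIdeal a := by
  obtain ⟨F, hFA, hF⟩ := Set.exists_subset_bijOn A principalRightIdeal
  refine ⟨F, hFA, Set.Finite.of_finite_image (hF.image_eq ▸ hA) hF.injOn, fun a ha => ?_⟩
  exact hF.surjOn ⟨a, ha, rfl⟩

end MeetsFinitelyManyRClasses

end RightIdeals

/-! ### The semilattice of J-classes -/

section Grading

variable {S : Type*} [Semigroup S] {Y : Type*} [SemilatticeInf Y]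

/-- A homomorphism to a semilattice whose fibres behave like the J-classes of a completely regular
semigroup: if `k s ≤ k t`, then multiplying `s` by `t` on the right (left) does not leave the
R-class (L-class) of `s`. -/
structure IsCompletelySimpleGrading (k : S → Y) : Prop where
  map_mul : ∀ s t, k (s * t) = k s ⊓ k t
  right : ∀ s t, k s ≤ k t → ∃ u, s * t * u = s
  left : ∀ s t, k s ≤ k t → ∃ u, u * (t * s) = s

lemma IsCompletelyRegular.exists_commuting_inverse (h : IsCompletelyRegular S) (x : S) :
    ∃ y, x * y * x = x ∧ x * y = y * x := by
  obtain ⟨T, ⟨e, -, he, hinv⟩, hx⟩ := h x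
  obtain ⟨y, -, hxy, hyx⟩ := hinv x hx
  exact ⟨y, by rw [hxy, (he x hx).1], hxy.trans hyx.symm⟩

/-- The two-sided ideal `S x S`; in a completely regular semigroup it contains `x`. -/
def principalIdeal (x : S) : Set S := {z | ∃ a b, z = a * x * b}

lemma principalIdeal_mul_left_subset (a x : S) : principalIdeal (a * x) ⊆ principalIdeal x := by
  rintro _ ⟨c, d, rfl⟩
  exact ⟨c * a, d, by simp only [mul_assoc]⟩

lemma principalIdeal_mul_right_subset (x b : S) : principalIdeal (x * b) ⊆ principalIdeal x := by
  rintro _ ⟨c, d, rfl⟩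
  exact ⟨c, b * d, by simp only [mul_assoc]⟩

lemma principalIdeal_subset_of_mem {x y : S} (hx : x ∈ principalIdeal y) :
    principalIdeal x ⊆ principalIdeal y := by
  obtain ⟨a, b, rfl⟩ := hx
  exact (principalIdeal_mul_right_subset _ b).trans (principalIdeal_mul_left_subset a y)

namespace IsCompletelyRegular

variable (h : IsCompletelyRegular S)
include h

lemma mem_principalIdeal_self (x : S) : x ∈ principalIdeal x := by
  obtain ⟨y, hy, hc⟩ := h.exists_commuting_inverse x
  exact ⟨x * y, x * y, by rw [hy, hc, ← mul_assoc, hy]⟩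

lemma principalIdeal_mul_comm_subset (x y : S) :
    principalIdeal (x * y) ⊆ principalIdeal (y * x) := by
  obtain ⟨w, hw, hc⟩ := h.exists_commuting_inverse (x * y)
  refine principalIdeal_subset_of_mem ⟨x, y * w, ?_⟩
  calc x * y = x * y * (x * y * w) := by rw [hc, ← mul_assoc, hw]
    _ = x * (y * x) * (y * w) := by simp only [mul_assoc]

lemma principalIdeal_mul (x y : S) :
    principalIdeal (x * y) = principalIdeal x ∩ principalIdeal y := by
  refine Set.Subset.antisymm (Set.subset_inter (principalIdeal_mul_right_subset x y)
    (principalIdeal_mul_left_subset x y)) ?_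
  rintro z ⟨⟨a, b, hx⟩, ⟨c, d, hy⟩⟩
  have hzz : z ∈ principalIdeal (z * z) := by
    obtain ⟨w, hw, hc⟩ := h.exists_commuting_inverse z
    refine ⟨w, z * w, ?_⟩
    rw [← mul_assoc w z z, ← hc, hw, hc, ← mul_assoc, hw]
  have hzz' : z * z = c * (y * (d * a * x)) * b := by
    nth_rewrite 1 [hy]
    rw [hx]
    simp only [mul_assoc]
  rw [hzz'] at hzz
  refine principalIdeal_mul_left_subset (d * a) (x * y) ?_
  rw [← mul_assoc]
  refine h.principalIdeal_mul_comm_subset _ _ ?_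
  exact principalIdeal_mul_left_subset _ _ (principalIdeal_mul_right_subset _ _ hzz)

lemma isCompletelySimpleGrading_principalIdeal :
    IsCompletelySimpleGrading (principalIdeal : S → Set S) where
  map_mul := h.principalIdeal_mul
  right s t hst := by
    have hs : s ∈ principalIdeal (s * t) := by
      rw [h.principalIdeal_mul]
      exact ⟨h.mem_principalIdeal_self s, hst (h.mem_principalIdeal_self s)⟩
    obtain ⟨a, b, hs⟩ := hs
    obtain ⟨w, hw, hc⟩ := h.exists_commuting_inverse (t * b)
    refine ⟨b * w, ?_⟩
    calc s * t * (b * w) = a * (s * t) * b * (t * b * w) := by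
          rw [← hs]; simp only [mul_assoc]
      _ = a * s * (t * b * (t * b * w)) := by simp only [mul_assoc]
      _ = a * s * (t * b) := by rw [hc, ← mul_assoc (t * b) w, hw]
      _ = s := by rw [← mul_assoc, mul_assoc a s t, ← hs]
  left s t hst := by
    have hs : s ∈ principalIdeal (t * s) := by
      rw [h.principalIdeal_mul]
      exact ⟨hst (h.mem_principalIdeal_self s), h.mem_principalIdeal_self s⟩
    obtain ⟨a, b, hs⟩ := hs
    obtain ⟨w, hw, hc⟩ := h.exists_commuting_inverse (a * t)
    refine ⟨w * a, ?_⟩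
    calc w * a * (t * s) = w * (a * t) * (a * (t * s) * b) := by
          rw [← hs]; simp only [mul_assoc]
      _ = w * (a * t) * (a * t) * (s * b) := by simp only [mul_assoc]
      _ = a * t * (s * b) := by rw [← hc, hw]
      _ = s := by rw [← mul_assoc, mul_assoc a t s, ← hs]

end IsCompletelyRegular

namespace IsCompletelySimpleGrading

variable {k : S → Y}

lemma le_left (hk : IsCompletelySimpleGrading k) (s t : S) : k (s * t) ≤ k s :=
  hk.map_mul s t ▸ inf_le_left

lemma le_right (hk : IsCompletelySimpleGrading k) (s t : S) : k (s * t) ≤ k t :=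
  hk.map_mul s t ▸ inf_le_right

lemma principalRightIdeal_mul (hk : IsCompletelySimpleGrading k) {s t : S} (h : k s ≤ k t) :
    principalRightIdeal (s * t) = principalRightIdeal s :=
  let ⟨_, hu⟩ := hk.right s t h
  principalRightIdeal_mul_eq_self hu

lemma eq_of_principalRightIdeal_eq (hk : IsCompletelySimpleGrading k) {s t : S}
    (h : principalRightIdeal s = principalRightIdeal t) : k s = k t := by
  have key : ∀ {s t : S}, principalRightIdeal s = principalRightIdeal t → k s ≤ k t := by
    intro s t h
    have hs : s ∈ principalRightIdeal t := h ▸ Set.mem_insert s _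
    rcases hs with rfl | ⟨u, rfl⟩
    · exact le_rfl
    · exact hk.le_left t u
  exact le_antisymm (key h) (key h.symm)

/-- The L-class of `s` contains an idempotent in the J-class of `s`. -/
lemma exists_idempotent (hk : IsCompletelySimpleGrading k) (s : S) :
    ∃ e, e * e = e ∧ s * e = s ∧ k e = k s := by
  obtain ⟨u, hu⟩ := hk.right s s le_rfl
  obtain ⟨v, hv⟩ := hk.left s s le_rfl
  have hvu : v * s = s * u := by
    conv_lhs => rw [← hu]
    rw [← mul_assoc, hv]
  have hse : s * (v * s) = s := by rw [hvu, ← mul_assoc, hu]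
  refine ⟨v * s, by rw [mul_assoc, hse], hse, le_antisymm (hk.le_right v s) ?_⟩
  conv_lhs => rw [← hse]
  exact hk.le_right _ _

/-- The values of the grading form a finitely generated semilattice, which is finite. -/
lemma finite_range (hk : IsCompletelySimpleGrading k) (hS : IsFGSemigroup S) :
    (Set.range k).Finite := by
  obtain ⟨X, hX, hXS⟩ := hS
  refine (hX.image k).infClosure.subset ?_
  rintro _ ⟨s, rfl⟩
  have hs : s ∈ Subsemigroup.closure X := hXS ▸ Subsemigroup.mem_top s
  induction hs using Subsemigroup.closure_induction with
  | mem x hx => exact subset_infClosure ⟨x, hx, rfl⟩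
  | mul x y _ _ hx hy =>
    rw [hk.map_mul]
    exact infClosed_infClosure hx hy

end IsCompletelySimpleGrading

/-- The semilattice is that of the ideals `S x S`, one for each J-class. -/
lemma IsCompletelyRegular.exists_finite_grading (h : IsCompletelyRegular S)
    (hS : IsFGSemigroup S) :
    ∃ (P : Set (Set S)) (_ : SemilatticeInf P) (k : S → P), Finite P ∧
      IsCompletelySimpleGrading k := by
  have hk := h.isCompletelySimpleGrading_principalIdeal
  let P : Set (Set S) := Set.range principalIdeal
  have hP : ∀ ⦃x y : Set S⦄, x ∈ P → y ∈ P → x ⊓ y ∈ P := by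
    rintro _ _ ⟨s, rfl⟩ ⟨t, rfl⟩
    exact ⟨s * t, hk.map_mul s t⟩
  refine ⟨P, Subtype.semilatticeInf hP, fun s => ⟨principalIdeal s, s, rfl⟩,
    (hk.finite_range hS).to_subtype, ?_⟩
  let _ := Subtype.semilatticeInf hP
  exact ⟨fun s t => Subtype.ext (hk.map_mul s t), fun s t => hk.right s t, fun s t => hk.left s t⟩

end Grading

/-! ### An infinite orbit of R-classes yields a semigroup `L(Q)` -/

section Orbit

variable {S : Type*} [Semigroup S] {G : Type*} [Group G]

/-- The elements of `G` that fix, under left multiplication through `φ`, every R-class in the orbit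
of the R-class of `x`. -/
def orbitKernel (φ : G →ₙ* S) (x : S) : Subgroup G where
  carrier := {g | ∀ h, principalRightIdeal (φ (g * h) * x) = principalRightIdeal (φ h * x)}
  mul_mem' := by
    intro a b ha hb h
    rw [mul_assoc, ha, hb]
  one_mem' := fun h => by rw [one_mul]
  inv_mem' := by
    intro a ha h
    rw [← ha, mul_inv_cancel_left]

instance orbitKernel_normal (φ : G →ₙ* S) (x : S) : (orbitKernel φ x).Normal where
  conj_mem := by
    intro n hn g h
    have := principalRightIdeal_mul_congr (φ g) (hn (g⁻¹ * h))
    simpa only [← mul_assoc, ← map_mul, mul_inv_cancel, one_mul] using this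

/-- The quotient by the kernel acts on the orbit. -/
lemma principalRightIdeal_eq_of_mk_eq {φ : G →ₙ* S} {x : S} {a b : G}
    (hab : (a : G ⧸ orbitKernel φ x) = b) (h : G) :
    principalRightIdeal (φ (a * h) * x) = principalRightIdeal (φ (b * h) * x) := by
  have hn : a * b⁻¹ ∈ orbitKernel φ x := by
    rw [← QuotientGroup.eq_one_iff, QuotientGroup.mk_mul, QuotientGroup.mk_inv, hab,
      mul_inv_cancel]
  have := hn (b * h)
  rwa [← mul_assoc, inv_mul_cancel_right] at this

/-- The action of the quotient by the kernel is faithful. -/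
lemma mk_eq_of_principalRightIdeal_eq {φ : G →ₙ* S} {x : S} {a b : G}
    (hab : ∀ h, principalRightIdeal (φ (a * h) * x) = principalRightIdeal (φ (b * h) * x)) :
    (a : G ⧸ orbitKernel φ x) = b := by
  have hn : a * b⁻¹ ∈ orbitKernel φ x := by
    intro h
    rw [mul_assoc, hab, mul_inv_cancel_left]
  rw [← QuotientGroup.eq_one_iff, QuotientGroup.mk_mul, QuotientGroup.mk_inv] at hn
  exact mul_inv_eq_one.mp hn

lemma infinite_quotient_orbitKernel {φ : G →ₙ* S} {x : S}
    (hinf : ¬ MeetsFinitelyManyRClasses (Set.range fun g => φ g * x)) :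
    Infinite (G ⧸ orbitKernel φ x) := by
  by_contra hfin
  rw [not_infinite_iff_finite] at hfin
  refine hinf ((MeetsFinitelyManyRClasses.of_finite
    (Set.finite_range fun q : G ⧸ orbitKernel φ x => φ q.out * x)).of_forall_exists ?_)
  rintro _ ⟨g, rfl⟩
  refine ⟨_, ⟨(g : G ⧸ orbitKernel φ x), rfl⟩, ?_⟩
  have := principalRightIdeal_eq_of_mk_eq (φ := φ) (x := x) (a := g)
    (b := (g : G ⧸ orbitKernel φ x).out) (QuotientGroup.out_eq' _).symm 1
  simpa only [mul_one] using this

/-- For `h : G`, a relation between `S` and `L(Q)`, where `Q` is the group acting on the orbit: the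
class of `g` is related to `φ g`, and its coset is related to all elements of the R-class of
`φ (g * h) * x`. Each of these relations is compatible with multiplication, and together they
determine the element of `L(Q)`. -/
def OrbitRel (φ : G →ₙ* S) (x : S) (h : G) (s : S) : LSemigroup (G ⧸ orbitKernel φ x) → Prop
  | .elt q => ∃ g : G, (g : G ⧸ orbitKernel φ x) = q ∧ s = φ g
  | .coset c => ∃ g : G, QuotientGroup.mk (g : G ⧸ orbitKernel φ x) = c ∧
      principalRightIdeal s = principalRightIdeal (φ (g * h) * x)

lemma OrbitRel.exists_rel (φ : G →ₙ* S) (x : S) (h : G) (l : LSemigroup (G ⧸ orbitKernel φ x)) :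
    ∃ s, OrbitRel φ x h s l := by
  rcases l with q | c
  · obtain ⟨g, rfl⟩ := QuotientGroup.mk_surjective q
    exact ⟨φ g, g, rfl, rfl⟩
  · obtain ⟨q, rfl⟩ := QuotientGroup.mk_surjective c
    obtain ⟨g, rfl⟩ := QuotientGroup.mk_surjective q
    exact ⟨φ (g * h) * x, g, rfl, rfl⟩

variable {Y : Type*} [SemilatticeInf Y] {k : S → Y}

lemma IsCompletelySimpleGrading.apply_hom_eq (hk : IsCompletelySimpleGrading k)
    (φ : G →ₙ* S) (a b : G) : k (φ a) = k (φ b) := by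
  have key : ∀ a b : G, k (φ a) ≤ k (φ b) := by
    intro a b
    calc k (φ a) = k (φ b * φ (b⁻¹ * a)) := by
          rw [← _root_.map_mul, mul_inv_cancel_left]
      _ ≤ k (φ b) := hk.le_left _ _
  exact le_antisymm (key a b) (key b a)

lemma OrbitRel.mul (hk : IsCompletelySimpleGrading k) {φ : G →ₙ* S} {x : S} {h : G} {s t : S}
    {l m : LSemigroup (G ⧸ orbitKernel φ x)} (hs : OrbitRel φ x h s l) (ht : OrbitRel φ x h t m) :
    OrbitRel φ x h (s * t) (l * m) := by
  rcases l with q | c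
  · obtain ⟨g, rfl, rfl⟩ := hs
    rcases m with q' | c'
    · obtain ⟨g', rfl, rfl⟩ := ht
      exact ⟨g * g', rfl, (map_mul φ g g').symm⟩
    · obtain ⟨g', rfl, ht⟩ := ht
      refine ⟨g * g', rfl, ?_⟩
      rw [principalRightIdeal_mul_congr _ ht, ← mul_assoc, ← map_mul, mul_assoc]
  · obtain ⟨g, rfl, hs⟩ := hs
    -- `t` lies in the J-class of the group or in that of the orbit, so it cannot move the R-class
    -- of `s`.
    have hst : k s ≤ k t := by
      rw [hk.eq_of_principalRightIdeal_eq hs]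
      rcases m with q' | c'
      · obtain ⟨g', -, rfl⟩ := ht
        rw [hk.apply_hom_eq φ g' (g * h)]
        exact hk.le_left _ _
      · obtain ⟨g', -, ht⟩ := ht
        rw [hk.eq_of_principalRightIdeal_eq ht, hk.map_mul, hk.map_mul,
          hk.apply_hom_eq φ (g * h) (g' * h)]
    exact ⟨g, rfl, (hk.principalRightIdeal_mul hst).trans hs⟩

lemma OrbitRel.lift (hk : IsCompletelySimpleGrading k) {φ : G →ₙ* S} {x : S} {h : G} {b : ℕ → S}
    {a : ℕ → LSemigroup (G ⧸ orbitKernel φ x)} (hab : ∀ i, OrbitRel φ x h (b i) (a i))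
    (w : FreeSemigroup ℕ) : OrbitRel φ x h (FreeSemigroup.lift b w) (FreeSemigroup.lift a w) := by
  induction w with
  | ih1 i => exact hab i
  | ih2 v w hv hw =>
    rw [map_mul, map_mul]
    exact hv.mul hk hw

lemma OrbitRel.eq_of_forall {φ : G →ₙ* S} {x : S}
    (hφ : ∀ a b, principalRightIdeal (φ a) ≠ principalRightIdeal (φ b * x))
    {l m : LSemigroup (G ⧸ orbitKernel φ x)}
    (hlm : ∀ h, ∃ s, OrbitRel φ x h s l ∧ OrbitRel φ x h s m) : l = m := by
  rcases l with q | c <;> rcases m with q' | c'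
  · obtain ⟨s, ⟨g, rfl, hs⟩, ⟨g', rfl, hs'⟩⟩ := hlm 1
    congr 1
    refine mk_eq_of_principalRightIdeal_eq fun h => ?_
    rw [map_mul, map_mul, ← hs, ← hs']
  · obtain ⟨s, ⟨g, rfl, rfl⟩, ⟨g', rfl, hs'⟩⟩ := hlm 1
    exact absurd hs' (hφ _ _)
  · obtain ⟨s, ⟨g, rfl, hs⟩, ⟨g', rfl, rfl⟩⟩ := hlm 1
    exact absurd hs (hφ _ _)
  · obtain ⟨q, rfl⟩ := QuotientGroup.mk_surjective c
    obtain ⟨q', rfl⟩ := QuotientGroup.mk_surjective c'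
    obtain ⟨g, rfl⟩ := QuotientGroup.mk_surjective q
    obtain ⟨g', rfl⟩ := QuotientGroup.mk_surjective q'
    congr 2
    have mk_inj : ∀ {a b : G ⧸ orbitKernel φ x},
        (QuotientGroup.mk a : (G ⧸ orbitKernel φ x) ⧸ (⊥ : Subgroup _)) = QuotientGroup.mk b →
          a = b := by
      intro a b hab
      rw [QuotientGroup.eq, Subgroup.mem_bot] at hab
      exact (inv_mul_eq_one.mp hab)
    refine mk_eq_of_principalRightIdeal_eq fun h => ?_
    obtain ⟨s, ⟨a, ha, hs⟩, ⟨b, hb, hs'⟩⟩ := hlm h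
    rw [← principalRightIdeal_eq_of_mk_eq (mk_inj ha) h, ← hs, hs',
      principalRightIdeal_eq_of_mk_eq (mk_inj hb) h]

/-- If the orbit of the R-class of `x` under a group is infinite, then the quotient `Q` of the group
that acts faithfully on the orbit is infinite and `L(Q)` lies in the variety generated by `S`. -/
theorem satisfiesIdentity_LSemigroup_of_orbit_infinite (hk : IsCompletelySimpleGrading k)
    {φ : G →ₙ* S} {x : S}
    (hinf : ¬ MeetsFinitelyManyRClasses (Set.range fun g => φ g * x)) {u v : FreeSemigroup ℕ}
    (huv : SatisfiesIdentity S u v) :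
    SatisfiesIdentity (LSemigroup (G ⧸ orbitKernel φ x)) u v := by
  -- The orbit lies strictly below the group: otherwise it would be a single R-class.
  have hφ : ∀ a b, principalRightIdeal (φ a) ≠ principalRightIdeal (φ b * x) := by
    intro a b hab
    have hx : k (φ 1) ≤ k x := by
      rw [hk.apply_hom_eq φ 1 a, hk.eq_of_principalRightIdeal_eq hab]
      exact hk.le_right _ _
    refine hinf ((MeetsFinitelyManyRClasses.of_finite
      (Set.finite_singleton (φ 1))).of_forall_exists ?_)
    rintro _ ⟨g, rfl⟩
    refine ⟨_, rfl, ?_⟩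
    dsimp only
    rw [hk.principalRightIdeal_mul ((hk.apply_hom_eq φ g 1).trans_le hx), ← one_mul g, map_mul]
    exact hk.principalRightIdeal_mul (hk.apply_hom_eq φ 1 g).le
  intro a
  refine OrbitRel.eq_of_forall hφ fun h => ?_
  choose b hb using fun i => OrbitRel.exists_rel φ x h (a i)
  refine ⟨FreeSemigroup.lift b u, OrbitRel.lift hk hb u, ?_⟩
  rw [huv b]
  exact OrbitRel.lift hk hb v

end Orbit

/-! ### The local monoid of an idempotent -/

section LocalMonoid

variable {S : Type*} [Semigroup S]

/-- The monoid `e S e` of the elements for which the idempotent `e` acts as the identity. Its group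
of units is the H-class of `e`. -/
def LocalMonoid {e : S} (_ : e * e = e) : Type _ := {s : S // e * s = s ∧ s * e = s}

instance {e : S} (he : e * e = e) : Monoid (LocalMonoid he) where
  mul s t := ⟨s.1 * t.1, by rw [← mul_assoc, s.2.1], by rw [mul_assoc, t.2.2]⟩
  mul_assoc s t r := Subtype.ext (mul_assoc s.1 t.1 r.1)
  one := ⟨e, he, he⟩
  one_mul s := Subtype.ext s.2.1
  mul_one s := Subtype.ext s.2.2

/-- The inclusion of a group of units of a local monoid. -/
def LocalMonoid.inclusion {e : S} (he : e * e = e) (G : Subgroup (LocalMonoid he)ˣ) : G →ₙ* S where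
  toFun g := g.1.1.1
  map_mul' _ _ := rfl

variable {Y : Type*} [SemilatticeInf Y] {k : S → Y}

/-- An element of `e S e` in the J-class of `e` is a unit. -/
lemma IsCompletelySimpleGrading.exists_unit (hk : IsCompletelySimpleGrading k) {e s : S}
    (he : e * e = e) (hs : e * s = s ∧ s * e = s) (hle : k e ≤ k s) :
    ∃ g : (LocalMonoid he)ˣ, g.1.1 = s := by
  obtain ⟨u, hu⟩ := hk.right e s hle
  obtain ⟨v, hv⟩ := hk.left e s hle
  rw [hs.1] at hu
  rw [hs.2] at hv
  let s' : LocalMonoid he := ⟨s, hs⟩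
  let u' : LocalMonoid he := ⟨e * u * e, by rw [← mul_assoc, ← mul_assoc, he], by
    rw [mul_assoc, he]⟩
  let v' : LocalMonoid he := ⟨e * v * e, by rw [← mul_assoc, ← mul_assoc, he], by
    rw [mul_assoc, he]⟩
  have hu' : s' * u' = 1 := Subtype.ext <| by
    change s * (e * u * e) = e
    rw [← mul_assoc, ← mul_assoc, hs.2, hu, he]
  have hv' : v' * s' = 1 := Subtype.ext <| by
    change e * v * e * s = e
    rw [mul_assoc, hs.1, mul_assoc, hv, he]
  have huv : v' = u' := left_inv_eq_right_inv hv' hu'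
  exact ⟨⟨s', u', hu', huv ▸ hv'⟩, rfl⟩

end LocalMonoid

/-! ### Finitely many R-classes from finite orbits -/

section Finiteness

variable {S : Type*} [Semigroup S] {Y : Type*} [SemilatticeInf Y] {k : S → Y}

namespace IsCompletelySimpleGrading

/-- The L-class of an idempotent `e` whose J-class has finitely many R-classes is the product of a
finite set with a finitely generated subgroup of the H-class of `e`. As in Schreier's lemma, the
group is generated by the elements that correct `x * r` to a chosen representative `r'` of its
R-class, for generators `x` and representatives `r`. -/
lemma exists_schreier_generators (hk : IsCompletelySimpleGrading k) {X : Set S} (hX : X.Finite)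
    (hXS : Subsemigroup.closure X = ⊤) {e : S} (he : e * e = e)
    (hfin : MeetsFinitelyManyRClasses {s | k s = k e}) :
    ∃ (F : Set S) (G : Subgroup (LocalMonoid he)ˣ), F.Finite ∧ G.FG ∧
      ∀ h, h * e = h → k h = k e → ∃ r ∈ F, ∃ g : G, h = r * LocalMonoid.inclusion he G g := by
  let Z : Set S := {h | h * e = h ∧ k h = k e}
  have hZ : MeetsFinitelyManyRClasses Z := hfin.mono fun h hh => hh.2
  obtain ⟨F₀, hF₀Z, hF₀, hrep⟩ := hZ.exists_representatives
  let F : Set S := insert e F₀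
  have hFZ : F ⊆ Z := Set.insert_subset ⟨he, rfl⟩ hF₀Z
  have hF : F.Finite := hF₀.insert e
  -- an element of the L-class differs from its representative by a unit
  have hunit : ∀ h ∈ Z, ∃ r ∈ F, ∃ g : (LocalMonoid he)ˣ, h = r * g.1.1 := by
    rintro h ⟨hhe, hkh⟩
    obtain ⟨r, hr, hrh⟩ := hrep h ⟨hhe, hkh⟩
    have hre := (hF₀Z hr).1
    have hmem : h ∈ principalRightIdeal r := hrh ▸ Set.mem_insert h _
    obtain ⟨s, hs⟩ : ∃ s, r * s = h := by
      rcases hmem with rfl | ⟨s, hs⟩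
      · exact ⟨e, hhe⟩
      · exact ⟨s, hs⟩
    have hes : r * (e * s * e) = h := by
      rw [← mul_assoc, ← mul_assoc, hre, hs, hhe]
    obtain ⟨g, hg⟩ := hk.exists_unit he (s := e * s * e)
      ⟨by rw [← mul_assoc, ← mul_assoc, he], by rw [mul_assoc, he]⟩
      (by rw [← hkh]; conv_lhs => rw [← hes]
          exact hk.le_right _ _)
    exact ⟨r, Set.mem_insert_of_mem e hr, g, by rw [hg, hes]⟩
  choose! ρ hρF γ hγ using hunit
  let T : Set (LocalMonoid he)ˣ := (fun p : S × S => γ (p.1 * p.2)) '' (X ×ˢ F)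
  have hT : T.Finite := (hX.prod hF).image _
  let G : Subgroup (LocalMonoid he)ˣ := Subgroup.closure T
  refine ⟨F, G, hF, (Subgroup.fg_iff G).mpr ⟨T, rfl, hT⟩, ?_⟩
  have hstep : ∀ w : S, ∀ r ∈ F, ∀ g ∈ G, k (w * (r * g.1.1)) = k e →
      ∃ r' ∈ F, ∃ g' ∈ G, w * (r * g.1.1) = r' * g'.1.1 := by
    intro w
    have hw : w ∈ Subsemigroup.closure X := hXS ▸ Subsemigroup.mem_top w
    induction hw using Subsemigroup.closure_induction with
    | mem x hx =>
      intro r hr g hg hkw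
      rw [← mul_assoc] at hkw ⊢
      have hxr : x * r ∈ Z := by
        refine ⟨by rw [mul_assoc, (hFZ hr).1], le_antisymm ?_ ?_⟩
        · exact (hk.le_right x r).trans_eq (hFZ hr).2
        · exact hkw ▸ hk.le_left _ _
      refine ⟨ρ (x * r), hρF _ hxr, γ (x * r) * g,
        G.mul_mem (Subgroup.subset_closure ⟨(x, r), ⟨hx, hr⟩, rfl⟩) hg, ?_⟩
      nth_rewrite 1 [hγ _ hxr]
      exact mul_assoc _ _ _
    | mul w₁ w₂ _ _ ih₁ ih₂ =>
      intro r hr g hg hkw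
      rw [mul_assoc] at hkw ⊢
      have hkw₂ : k (w₂ * (r * g.1.1)) = k e := by
        refine le_antisymm ?_ (hkw ▸ hk.le_right _ _)
        exact (hk.le_right _ _).trans ((hk.le_left _ _).trans_eq (hFZ hr).2)
      obtain ⟨r', hr', g', hg', hw₂⟩ := ih₂ r hr g hg hkw₂
      rw [hw₂] at hkw ⊢
      exact ih₁ r' hr' g' hg' hkw
  intro h hhe hkh
  have hee : e * (1 : (LocalMonoid he)ˣ).1.1 = e := he
  obtain ⟨r, hr, g, hg, hh⟩ := hstep h e (Set.mem_insert e F₀) 1 G.one_mem (by rwa [hee, hhe])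
  rw [hee, hhe] at hh
  exact ⟨r, hr, ⟨g, hg⟩, hh⟩

/-- If multiplying `h` on the right by `w` lowers the grading, the R-class of `h * w` is that of the
prefix `q * x` of this product, where `x` is the last generator at which the grading drops. -/
lemma exists_prefix_of_mul (hk : IsCompletelySimpleGrading k) {X : Set S}
    (hXS : Subsemigroup.closure X = ⊤) (w : S) :
    ∀ h, k (h * w) ≠ k h → ∃ q, ∃ x ∈ X, k (q * x) = k (h * w) ∧ k (h * w) < k q ∧
      principalRightIdeal (h * w) = principalRightIdeal (q * x) := by
  have hw : w ∈ Subsemigroup.closure X := hXS ▸ Subsemigroup.mem_top w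
  induction hw using Subsemigroup.closure_induction with
  | mem x hx =>
    intro h hne
    exact ⟨h, x, hx, rfl, lt_of_le_of_ne (hk.le_left h x) hne, rfl⟩
  | mul w₁ w₂ _ _ ih₁ ih₂ =>
    intro h hne
    rw [← mul_assoc] at hne ⊢
    by_cases heq : k (h * w₁ * w₂) = k (h * w₁)
    · obtain ⟨q, x, hx, h₁, h₂, h₃⟩ := ih₁ h (heq ▸ hne)
      refine ⟨q, x, hx, h₁.trans heq.symm, heq.trans_lt h₂, Eq.trans ?_ h₃⟩
      exact hk.principalRightIdeal_mul (heq ▸ hk.le_right _ _)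
    · exact ih₂ _ heq

/-- The R-class of `w` is that of a generator, or of a product `q * x` with `x` a generator and `q`
strictly above `w`. -/
lemma exists_prefix (hk : IsCompletelySimpleGrading k) {X : Set S}
    (hXS : Subsemigroup.closure X = ⊤) (w : S) :
    (∃ x ∈ X, principalRightIdeal w = principalRightIdeal x) ∨
      ∃ q, ∃ x ∈ X, k (q * x) = k w ∧ k w < k q ∧
        principalRightIdeal w = principalRightIdeal (q * x) := by
  have hw : w ∈ Subsemigroup.closure X := hXS ▸ Subsemigroup.mem_top w
  induction hw using Subsemigroup.closure_induction with
  | mem x hx => exact Or.inl ⟨x, hx, rfl⟩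
  | mul w₁ w₂ _ _ ih₁ _ =>
    by_cases heq : k (w₁ * w₂) = k w₁
    · have hR : principalRightIdeal (w₁ * w₂) = principalRightIdeal w₁ :=
        hk.principalRightIdeal_mul (heq ▸ hk.le_right _ _)
      rwa [hR, heq]
    · exact Or.inr (hk.exists_prefix_of_mul hXS w₂ w₁ heq)

/-- Every element lies in `S * p` for an element `p` of the same
J-class that is a generator, or a product `z * w` with `z` a generator and `w` strictly above. -/
lemma exists_suffix (hk : IsCompletelySimpleGrading k) {X : Set S}
    (hXS : Subsemigroup.closure X = ⊤) (q : S) :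
    ∃ p, (p ∈ X ∨ ∃ z ∈ X, ∃ w, p = z * w ∧ k p < k w) ∧ k p = k q ∧ ∃ s, q = s * p := by
  have hmul : ∀ w : S, ∀ h, k (w * h) ≠ k h →
      ∃ z ∈ X, ∃ v, k (z * v) < k v ∧ k (z * v) = k (w * h) ∧ ∃ s, w * h = s * (z * v) := by
    intro w
    have hw : w ∈ Subsemigroup.closure X := hXS ▸ Subsemigroup.mem_top w
    induction hw using Subsemigroup.closure_induction with
    | mem x hx =>
      intro h hne
      obtain ⟨u, hu⟩ := hk.left (x * h) (x * h) le_rfl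
      exact ⟨x, hx, h, lt_of_le_of_ne (hk.le_right x h) hne, rfl, u * (x * h),
        by rw [mul_assoc, hu]⟩
    | mul w₁ w₂ _ _ ih₁ ih₂ =>
      intro h hne
      rw [mul_assoc] at hne ⊢
      by_cases heq : k (w₁ * (w₂ * h)) = k (w₂ * h)
      · obtain ⟨z, hz, v, h₁, h₂, s, hs⟩ := ih₂ h (heq ▸ hne)
        exact ⟨z, hz, v, h₁, h₂.trans heq.symm, w₁ * s, by rw [hs, mul_assoc]⟩
      · exact ih₁ _ heq
  have hq : q ∈ Subsemigroup.closure X := hXS ▸ Subsemigroup.mem_top q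
  induction hq using Subsemigroup.closure_induction with
  | mem x hx =>
    obtain ⟨u, hu⟩ := hk.left x x le_rfl
    exact ⟨x, Or.inl hx, rfl, u * x, by rw [mul_assoc, hu]⟩
  | mul w₁ w₂ _ _ _ ih₂ =>
    by_cases heq : k (w₁ * w₂) = k w₂
    · obtain ⟨p, hp, hpk, s, hs⟩ := ih₂
      exact ⟨p, hp, hpk.trans heq.symm, w₁ * s, by rw [mul_assoc, ← hs]⟩
    · obtain ⟨z, hz, v, h₁, h₂, s, hs⟩ := hmul w₁ w₂ heq
      exact ⟨z * v, Or.inr ⟨z, hz, v, rfl, h₁⟩, h₂, s, hs⟩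

/-- Under the hypothesis on orbits, right translation by `x` takes each L-class of a J-class with
finitely many R-classes to a set meeting finitely many R-classes. -/
lemma meetsFinitelyManyRClasses_leftMultiples_mul (hk : IsCompletelySimpleGrading k) {X : Set S}
    (hX : X.Finite) (hXS : Subsemigroup.closure X = ⊤)
    (horb : ∀ (e : S) (he : e * e = e) (G : Subgroup (LocalMonoid he)ˣ), G.FG → ∀ x : S,
      MeetsFinitelyManyRClasses (Set.range fun g : G => LocalMonoid.inclusion he G g * x))
    (p x : S) (hfin : MeetsFinitelyManyRClasses {s | k s = k p}) :
    MeetsFinitelyManyRClasses {t | ∃ s, k (s * p) = k p ∧ t = s * p * x} := by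
  obtain ⟨e, he, hpe, hke⟩ := hk.exists_idempotent p
  rw [← hke] at hfin
  obtain ⟨F, G, hF, hG, hFG⟩ := hk.exists_schreier_generators hX hXS he hfin
  refine (MeetsFinitelyManyRClasses.biUnion hF fun r _ => (horb e he G hG x).mul_left r).mono ?_
  rintro _ ⟨s, hs, rfl⟩
  obtain ⟨r, hr, g, hg⟩ := hFG (s * p) (by rw [mul_assoc, hpe]) (hs.trans hke.symm)
  exact Set.mem_biUnion hr ⟨_, ⟨g, rfl⟩, by rw [hg, mul_assoc]⟩

/-- Let all J-classes strictly above `d` meet finitely many R-classes. Then so do the products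
`q * x` in `d` with `q` in a fixed J-class `c` above `d`. By induction on `c`, there are finitely
many R-classes of products `p * x` for suffixes `p` of elements of `c`; hence finitely many `p`
suffice, and for each of them the left multiples are covered by the hypothesis on orbits. -/
lemma meetsFinitelyManyRClasses_mul_generator (hk : IsCompletelySimpleGrading k) [Finite Y]
    {X : Set S} (hX : X.Finite) (hXS : Subsemigroup.closure X = ⊤)
    (horb : ∀ (e : S) (he : e * e = e) (G : Subgroup (LocalMonoid he)ˣ), G.FG → ∀ x : S,
      MeetsFinitelyManyRClasses (Set.range fun g : G => LocalMonoid.inclusion he G g * x))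
    (d : Y) (hd : ∀ c, d < c → MeetsFinitelyManyRClasses {s | k s = c}) (x : S) :
    ∀ c, d < c → c ⊓ k x = d → MeetsFinitelyManyRClasses ((fun q => q * x) '' {q | k q = c}) := by
  intro c
  induction c using WellFoundedGT.induction with
  | ind c ih =>
  intro hdc hcx
  -- the elements `w * x` with `w` strictly above `c` lie in the J-class `d`, where the induction
  -- applies, or above it
  have habove : MeetsFinitelyManyRClasses {t | ∃ w, c < k w ∧ t = w * x} := by
    refine (MeetsFinitelyManyRClasses.biUnion (Set.toFinite {c' : Y | c < c'})
      (f := fun c' => (fun q => q * x) '' {q | k q = c'}) fun c' hc' => ?_).mono ?_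
    · have hle : d ≤ c' ⊓ k x := hcx ▸ inf_le_inf_right _ (le_of_lt hc')
      rcases hle.eq_or_lt with heq | hlt
      · exact ih c' hc' (hdc.trans hc') heq.symm
      · refine (hd _ hlt).mono ?_
        rintro _ ⟨q, rfl, rfl⟩
        exact hk.map_mul q x
    · rintro _ ⟨w, hw, rfl⟩
      exact Set.mem_biUnion (x := k w) hw ⟨w, rfl, rfl⟩
  let P : Set S := {p | (p ∈ X ∨ ∃ z ∈ X, ∃ w, p = z * w ∧ k p < k w) ∧ k p = c}
  have hPx : MeetsFinitelyManyRClasses ((fun p => p * x) '' P) := by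
    refine ((MeetsFinitelyManyRClasses.of_finite (hX.image fun z => z * x)).union
      (MeetsFinitelyManyRClasses.biUnion hX fun z _ => habove.mul_left z)).mono ?_
    rintro _ ⟨p, ⟨hp | ⟨z, hz, w, rfl, hw⟩, hpc⟩, rfl⟩
    · exact Or.inl ⟨p, hp, rfl⟩
    · exact Or.inr (Set.mem_biUnion hz ⟨w * x, ⟨w, hpc ▸ hw, rfl⟩, (mul_assoc z w x).symm⟩)
  have hP : MeetsFinitelyManyRClasses P := (hd c hdc).mono fun p hp => hp.2
  -- finitely many suffixes represent all pairs formed by the R-classes of `p` and of `p * x`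
  let f : S → Set S × Set S := fun p => (principalRightIdeal p, principalRightIdeal (p * x))
  have hf : (f '' P).Finite := by
    refine (Set.Finite.prod hP hPx).subset ?_
    rintro _ ⟨p, hp, rfl⟩
    exact ⟨⟨p, hp, rfl⟩, ⟨p * x, ⟨p, hp, rfl⟩, rfl⟩⟩
  obtain ⟨P₀, hP₀P, hP₀⟩ := Set.exists_subset_bijOn P f
  have hP₀fin : P₀.Finite := Set.Finite.of_finite_image (hP₀.image_eq ▸ hf) hP₀.injOn
  refine (MeetsFinitelyManyRClasses.biUnion hP₀fin fun p hp =>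
    hk.meetsFinitelyManyRClasses_leftMultiples_mul hX hXS horb p x
      ((hP₀P hp).2.symm ▸ hd c hdc)).of_forall_exists ?_
  rintro _ ⟨q, hq, rfl⟩
  obtain ⟨p, hp, hpq, s, rfl⟩ := hk.exists_suffix hXS q
  have hpc : k p = c := hpq.trans hq
  obtain ⟨p₀, hp₀, hfp⟩ := hP₀.surjOn ⟨p, ⟨hp, hpc⟩, rfl⟩
  obtain ⟨h₁, h₂⟩ := Prod.ext_iff.mp hfp
  refine ⟨s * p₀ * x, Set.mem_biUnion hp₀ ⟨s, ?_, rfl⟩, ?_⟩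
  · rw [hk.eq_of_principalRightIdeal_eq (principalRightIdeal_mul_congr s h₁),
      hk.eq_of_principalRightIdeal_eq h₁, hpq]
  · simp only [mul_assoc]
    exact (principalRightIdeal_mul_congr s h₂).symm

/-- If every finitely generated subgroup has finite orbits on R-classes, then there are finitely
many R-classes. -/
theorem finite_quotient_greenR (hk : IsCompletelySimpleGrading k) [Finite Y]
    (hS : IsFGSemigroup S)
    (horb : ∀ (e : S) (he : e * e = e) (G : Subgroup (LocalMonoid he)ˣ), G.FG → ∀ x : S,
      MeetsFinitelyManyRClasses (Set.range fun g : G => LocalMonoid.inclusion he G g * x)) :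
    Finite (Quotient (greenR S)) := by
  obtain ⟨X, hX, hXS⟩ := hS
  have hmain : ∀ d, MeetsFinitelyManyRClasses {s | k s = d} := by
    intro d
    induction d using WellFoundedGT.induction with
    | ind d hd =>
    refine ((MeetsFinitelyManyRClasses.of_finite hX).union
      (MeetsFinitelyManyRClasses.biUnion hX fun x _ =>
        MeetsFinitelyManyRClasses.biUnion (Set.toFinite {c : Y | d < c ∧ c ⊓ k x = d})
          fun c hc => hk.meetsFinitelyManyRClasses_mul_generator hX hXS horb d hd x c
            hc.1 hc.2)).of_forall_exists ?_
    rintro w rfl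
    rcases hk.exists_prefix hXS w with ⟨x, hx, hwx⟩ | ⟨q, x, hx, hqx, hlt, hwq⟩
    · exact ⟨x, Or.inl hx, hwx⟩
    · refine ⟨q * x, Or.inr (Set.mem_biUnion hx (Set.mem_biUnion (x := k q) ?_ ⟨q, rfl, rfl⟩)), hwq⟩
      exact ⟨hlt, (hk.map_mul q x).symm.trans hqx⟩
  rw [finite_quotient_greenR_iff]
  refine (MeetsFinitelyManyRClasses.biUnion (Set.finite_univ (α := Y))
    fun d _ => hmain d).mono fun s _ => ?_
  exact Set.mem_biUnion (Set.mem_univ (k s)) rfl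

end IsCompletelySimpleGrading

end Finiteness

/-- A finitely generated completely regular semigroup with infinitely many R-classes generates a
variety containing `L(Q)` for some infinite finitely generated group `Q`. -/
theorem exists_LSemigroup_of_infinite_quotient_greenR {S : Type u} [Semigroup S]
    (hcr : IsCompletelyRegular S) (hS : IsFGSemigroup S) (hinf : ¬ Finite (Quotient (greenR S))) :
    ∃ (Q : Type u) (_ : Group Q), Infinite Q ∧ Group.FG Q ∧
      ∀ u v, SatisfiesIdentity S u v → SatisfiesIdentity (LSemigroup Q) u v := by
  obtain ⟨P, _, k, _, hk⟩ := hcr.exists_finite_grading hS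
  by_contra hcon
  refine hinf (hk.finite_quotient_greenR hS fun e he G hG x => ?_)
  by_contra horb
  refine hcon ⟨G ⧸ orbitKernel (LocalMonoid.inclusion he G) x, inferInstance,
    infinite_quotient_orbitKernel horb, ?_,
    fun u v => satisfiesIdentity_LSemigroup_of_orbit_infinite hk horb⟩
  have : Group.FG G := (Group.fg_iff_subgroup_fg G).mpr hG
  exact QuotientGroup.fg _

/-! ### Identities and constructions on semigroups -/

section Identities

variable {S T : Type*} [Semigroup S] [Semigroup T]

lemma map_freeSemigroup_lift (f : S →ₙ* T) (a : ℕ → S) (w : FreeSemigroup ℕ) :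
    f (FreeSemigroup.lift a w) = FreeSemigroup.lift (f ∘ a) w := by
  induction w with
  | ih1 i => rfl
  | ih2 v w hv hw => rw [map_mul, map_mul, map_mul, hv, hw]

lemma SatisfiesIdentity.of_injective {u v : FreeSemigroup ℕ} (h : SatisfiesIdentity T u v)
    (f : S →ₙ* T) (hf : Function.Injective f) : SatisfiesIdentity S u v := fun a =>
  hf (by rw [map_freeSemigroup_lift, map_freeSemigroup_lift, h])

lemma SatisfiesIdentity.pi {ι : Type*} {u v : FreeSemigroup ℕ} (h : SatisfiesIdentity S u v) :
    SatisfiesIdentity (ι → S) u v := fun a => funext fun i => by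
  have := h (Pi.evalMulHom (fun _ : ι => S) i ∘ a)
  rwa [← map_freeSemigroup_lift, ← map_freeSemigroup_lift] at this

/-- The reversal of words. -/
def FreeSemigroup.reverse (w : FreeSemigroup ℕ) : FreeSemigroup ℕ :=
  (FreeSemigroup.lift (fun i => MulOpposite.op (FreeSemigroup.of i)) w).unop

lemma FreeSemigroup.lift_reverse (a : ℕ → S) (w : FreeSemigroup ℕ) :
    FreeSemigroup.lift a w.reverse =
      (FreeSemigroup.lift (fun i => MulOpposite.op (a i)) w).unop := by
  induction w with
  | ih1 i => rfl
  | ih2 v w hv hw =>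
    simp only [reverse, map_mul, MulOpposite.unop_mul] at hv hw ⊢
    rw [hv, hw]

lemma satisfiesIdentity_reverse {u v : FreeSemigroup ℕ} :
    SatisfiesIdentity S u.reverse v.reverse ↔ SatisfiesIdentity Sᵐᵒᵖ u v := by
  constructor
  · intro h a
    have := h fun i => (a i).unop
    rw [FreeSemigroup.lift_reverse, FreeSemigroup.lift_reverse] at this
    exact MulOpposite.unop_injective this
  · intro h a
    rw [FreeSemigroup.lift_reverse, FreeSemigroup.lift_reverse, h]

end Identities

lemma IsSemigroupVariety.of_identities {V : (S : Type u) → [Semigroup S] → Prop}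
    (hV : IsSemigroupVariety V) {S T : Type u} [Semigroup S] [Semigroup T] (hS : V S)
    (h : ∀ u v, SatisfiesIdentity S u v → SatisfiesIdentity T u v) : V T := by
  obtain ⟨E, hE⟩ := hV
  exact (hE T).mpr fun p hp => h _ _ ((hE S).mp hS p hp)

lemma IsSemigroupVariety.mulOpposite {V : (S : Type u) → [Semigroup S] → Prop}
    (hV : IsSemigroupVariety V) : IsSemigroupVariety fun S [Semigroup S] => V Sᵐᵒᵖ := by
  obtain ⟨E, hE⟩ := hV
  refine ⟨(fun p => (p.1.reverse, p.2.reverse)) '' E, fun S _ => ?_⟩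
  refine (hE Sᵐᵒᵖ).trans ?_
  simp only [Set.forall_mem_image, satisfiesIdentity_reverse]

/-! ### Duality -/

section Duality

variable {S T : Type*} [Semigroup S] [Semigroup T]

lemma IsCompletelyRegular.of_mulOpposite (h : IsCompletelyRegular Sᵐᵒᵖ) :
    IsCompletelyRegular S := by
  intro x
  obtain ⟨U, ⟨e, heU, he, hinv⟩, hx⟩ := h (MulOpposite.op x)
  refine ⟨U.unop, ⟨e.unop, heU, fun t ht => ?_, fun t ht => ?_⟩, hx⟩
  · exact ⟨MulOpposite.op_injective (he _ ht).2, MulOpposite.op_injective (he _ ht).1⟩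
  · obtain ⟨y, hy, hxy, hyx⟩ := hinv _ ht
    exact ⟨y.unop, hy, MulOpposite.op_injective hyx, MulOpposite.op_injective hxy⟩

lemma IsPeriodicSemigroup.of_mulOpposite (h : IsPeriodicSemigroup Sᵐᵒᵖ) :
    IsPeriodicSemigroup S := by
  intro x
  have hle : Subsemigroup.closure {x} ≤ (Subsemigroup.closure {MulOpposite.op x}).unop :=
    Subsemigroup.closure_le.mpr (Set.singleton_subset_iff.mpr
      (Subsemigroup.subset_closure (Set.mem_singleton (MulOpposite.op x))))
  exact ((h (MulOpposite.op x)).preimage MulOpposite.op_injective.injOn).subset hle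

lemma IsFGSemigroup.mulOpposite (h : IsFGSemigroup S) : IsFGSemigroup Sᵐᵒᵖ := by
  obtain ⟨X, hX, hXS⟩ := h
  refine ⟨MulOpposite.unop ⁻¹' X, hX.preimage MulOpposite.unop_injective.injOn, ?_⟩
  rw [← Subsemigroup.op_closure, hXS, Subsemigroup.op_top]

/-- An anti-isomorphism takes Green's relation L to Green's relation R. -/
lemma finite_quotient_greenL_iff (e : S ≃ T) (he : ∀ x y, e (x * y) = e y * e x) :
    Finite (Quotient (greenL S)) ↔ Finite (Quotient (greenR T)) := by
  have key : ∀ z : S, principalRightIdeal (e z) = e '' principalLeftIdeal z := by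
    intro z
    simp only [principalRightIdeal, principalLeftIdeal, Set.image_insert_eq, ← Set.range_comp]
    congr 1
    rw [← e.surjective.range_comp]
    congr 1
    funext s
    exact (he s z).symm
  refine (Quotient.congr e fun x y => ?_).finite_iff
  change principalLeftIdeal x = principalLeftIdeal y ↔
    principalRightIdeal (e x) = principalRightIdeal (e y)
  rw [key, key]
  exact e.injective.image_injective.eq_iff.symm

lemma finite_quotient_greenH_iff :
    Finite (Quotient (greenH S)) ↔
      Finite (Quotient (greenR S)) ∧ Finite (Quotient (greenL S)) := by
  have hR : ∀ x y, greenH S x y → greenR S x y := fun _ _ h => h.1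
  have hL : ∀ x y, greenH S x y → greenL S x y := fun _ _ h => h.2
  constructor
  · intro _
    exact ⟨Finite.of_surjective (Quotient.map' (s₁ := greenH S) (s₂ := greenR S) id hR)
        (Quotient.mk_surjective.of_comp (g := Quotient.mk (greenH S))),
      Finite.of_surjective (Quotient.map' (s₁ := greenH S) (s₂ := greenL S) id hL)
        (Quotient.mk_surjective.of_comp (g := Quotient.mk (greenH S)))⟩
  · rintro ⟨_, _⟩
    refine Finite.of_injective (fun q : Quotient (greenH S) =>
      (Quotient.map' (s₂ := greenR S) id hR q, Quotient.map' (s₂ := greenL S) id hL q)) ?_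
    intro p q
    induction p, q using Quotient.inductionOn₂ with
    | h a b =>
      intro hab
      exact Quotient.sound ⟨Quotient.exact (Prod.ext_iff.mp hab).1,
        Quotient.exact (Prod.ext_iff.mp hab).2⟩

end Duality

/-! ### The semigroups `L(G)` and `R(G)` -/

section Forbidden

variable (G : Type*) [Group G]

lemma isFGSemigroup_LSemigroup [Group.FG G] : IsFGSemigroup (LSemigroup G) := by
  obtain ⟨T, hT, hTfin⟩ := Monoid.fg_iff.mp (Group.fg_iff_monoid_fg.mp ‹Group.FG G›)
  let one : G ⧸ (⊥ : Subgroup G) := QuotientGroup.mk 1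
  let X : Set (LSemigroup G) := LeftCosetSemigroup.elt '' insert 1 T ∪ {.coset one}
  refine ⟨X, ((hTfin.insert 1).image _).union (Set.finite_singleton _), ?_⟩
  have helt : ∀ g : G, (.elt g : LSemigroup G) ∈ Subsemigroup.closure X := by
    intro g
    have hg : g ∈ Submonoid.closure T := hT ▸ Submonoid.mem_top g
    induction hg using Submonoid.closure_induction with
    | mem x hx => exact Subsemigroup.subset_closure (Or.inl ⟨x, Or.inr hx, rfl⟩)
    | one => exact Subsemigroup.subset_closure (Or.inl ⟨1, Or.inl rfl, rfl⟩)
    | mul x y _ _ hx hy => exact Subsemigroup.mul_mem _ hx hy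
  rw [eq_top_iff]
  rintro (g | c) -
  · exact helt g
  · obtain ⟨g, rfl⟩ := QuotientGroup.mk_surjective c
    have hone : (.coset one : LSemigroup G) ∈ Subsemigroup.closure X :=
      Subsemigroup.subset_closure (Or.inr rfl)
    have := Subsemigroup.mul_mem _ (helt g) hone
    change (.coset (QuotientGroup.mk (g * 1)) : LSemigroup G) ∈ _ at this
    rwa [mul_one] at this

/-- Each coset is a left zero, hence forms an R-class of its own. -/
lemma infinite_quotient_greenR_LSemigroup [Infinite G] :
    ¬ Finite (Quotient (greenR (LSemigroup G))) := by
  intro _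
  have hinj : Function.Injective fun g : G =>
      (Quotient.mk (greenR (LSemigroup G)) (.coset (QuotientGroup.mk g))) := by
    intro a b hab
    have hab' : principalRightIdeal (.coset (QuotientGroup.mk a) : LSemigroup G) =
      principalRightIdeal (.coset (QuotientGroup.mk b)) := Quotient.exact hab
    have ha : (.coset (QuotientGroup.mk a) : LSemigroup G) ∈
        principalRightIdeal (.coset (QuotientGroup.mk b) : LSemigroup G) :=
      hab' ▸ Set.mem_insert _ _
    have ha' : (.coset (QuotientGroup.mk a) : LSemigroup G) = .coset (QuotientGroup.mk b) := by
      rcases ha with h | ⟨_, h⟩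
      · exact h
      · exact h.symm
    injection ha' with h
    rw [QuotientGroup.eq, Subgroup.mem_bot] at h
    exact inv_mul_eq_one.mp h
  exact not_finite_iff_infinite.mpr ‹Infinite G› (Finite.of_injective _ hinj)

/-- Inversion in `G` takes `Eg` to `g⁻¹E`, and `R(G)` anti-isomorphically onto `L(G)`. -/
def RSemigroup.toOppositeLSemigroup : RSemigroup G →ₙ* (LSemigroup G)ᵐᵒᵖ where
  toFun
    | .elt g => MulOpposite.op (.elt g⁻¹)
    | .coset c => MulOpposite.op (.coset
        (QuotientGroup.quotientRightRelEquivQuotientLeftRel (⊥ : Subgroup G) c))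
  map_mul' := by
    rintro (a | a) (b | b)
    · exact congrArg (fun g => MulOpposite.op (LeftCosetSemigroup.elt g)) (mul_inv_rev a b)
    · rfl
    · induction a using Quotient.inductionOn with
      | h a =>
        exact congrArg (fun g => MulOpposite.op (LeftCosetSemigroup.coset (QuotientGroup.mk g)))
          (mul_inv_rev a b)
    · rfl

lemma RSemigroup.toOppositeLSemigroup_bijective :
    Function.Bijective (RSemigroup.toOppositeLSemigroup G) := by
  constructor
  · rintro (a | a) (b | b) h
    · injection MulOpposite.op_injective h with h
      rw [inv_injective h]
    · cases MulOpposite.op_injective h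
    · cases MulOpposite.op_injective h
    · injection MulOpposite.op_injective h with h
      rw [(QuotientGroup.quotientRightRelEquivQuotientLeftRel _).injective h]
  · rintro ⟨g | c⟩
    · exact ⟨.elt g⁻¹, congrArg (fun g => MulOpposite.op (LeftCosetSemigroup.elt g)) (inv_inv g)⟩
    · exact ⟨.coset ((QuotientGroup.quotientRightRelEquivQuotientLeftRel _).symm c),
        congrArg (fun c => MulOpposite.op (LeftCosetSemigroup.coset c))
          ((QuotientGroup.quotientRightRelEquivQuotientLeftRel _).apply_symm_apply c)⟩

/-- `R(G)` and the opposite of `L(G)` lie in the same varieties. -/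
lemma satisfiesIdentity_RSemigroup_iff {u v : FreeSemigroup ℕ} :
    SatisfiesIdentity (RSemigroup G) u v ↔ SatisfiesIdentity (LSemigroup G)ᵐᵒᵖ u v := by
  let e := MulEquiv.ofBijective _ (RSemigroup.toOppositeLSemigroup_bijective G)
  exact ⟨fun h => h.of_injective e.symm.toMulHom e.symm.injective,
    fun h => h.of_injective e.toMulHom e.injective⟩

end Forbidden

/-- The power `L(G) ^ G` contains the element whose coordinates are all elements of `G`; if its
powers form a finite set, then `G` has finite exponent. -/
lemma exponentExists_of_LSemigroup {V : (S : Type u) → [Semigroup S] → Prop}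
    (hV : IsSemigroupVariety V) (hper : ∀ (S : Type u) [Semigroup S], V S → IsPeriodicSemigroup S)
    {G : Type u} [Group G] (hG : V (LSemigroup G)) : Monoid.ExponentExists G := by
  have hfin := hper (G → LSemigroup G) (hV.of_identities hG fun u v h => h.pi)
    fun g => .elt g
  have hmem : ∀ n : ℕ, (fun g : G => (.elt (g ^ (n + 1)) : LSemigroup G)) ∈
      Subsemigroup.closure {(fun g => .elt g : G → LSemigroup G)} := by
    intro n
    induction n with
    | zero => exact Subsemigroup.subset_closure (by simp)
    | succ n ih =>
      have := Subsemigroup.mul_mem _ ih (Subsemigroup.subset_closure (Set.mem_singleton _))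
      convert this using 1
      funext g
      exact congrArg LeftCosetSemigroup.elt (pow_succ g (n + 1))
  obtain ⟨m, -, n, -, hne, hmn⟩ := Set.infinite_univ.exists_lt_map_eq_of_mapsTo
    (fun n _ => hmem n) hfin
  refine ⟨n - m, Nat.sub_pos_of_lt hne, fun g => ?_⟩
  have h := congrFun hmn g
  injection h with h
  have hsplit : g ^ (n + 1) = g ^ (n - m) * g ^ (m + 1) := by
    rw [← pow_add]
    congr 1
    omega
  rw [hsplit] at h
  exact right_eq_mul.mp h

/-! ### Locally finite varieties for Green's relations -/

theorem isLocallyRFinite_iff {V : (S : Type u) → [Semigroup S] → Prop}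
    (hV : IsSemigroupVariety V)
    (hpcr : ∀ (S : Type u) [Semigroup S], V S → IsPeriodicSemigroup S ∧ IsCompletelyRegular S) :
    IsLocallyRFinite V ↔ ∀ (G : Type u) [Group G], IsNovikovAdian G → ¬ V (LSemigroup G) := by
  constructor
  · rintro h G _ ⟨_, _, _⟩ hG
    exact infinite_quotient_greenR_LSemigroup G (h _ hG (isFGSemigroup_LSemigroup G))
  · intro h S _ hS hfg
    by_contra hinf
    obtain ⟨Q, _, hQ, hQfg, hQS⟩ :=
      exists_LSemigroup_of_infinite_quotient_greenR (hpcr S hS).2 hfg hinf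
    have hVQ := hV.of_identities hS hQS
    exact h Q ⟨hQ, hQfg, exponentExists_of_LSemigroup hV (fun S _ hS => (hpcr S hS).1) hVQ⟩ hVQ

lemma isLocallyLFinite_iff_mulOpposite {V : (S : Type u) → [Semigroup S] → Prop}
    (hV : IsSemigroupVariety V) :
    IsLocallyLFinite V ↔ IsLocallyRFinite fun S [Semigroup S] => V Sᵐᵒᵖ := by
  constructor
  · intro h S _ hS hfg
    exact (finite_quotient_greenL_iff MulOpposite.opEquiv.symm fun _ _ => rfl).mp
      (h Sᵐᵒᵖ hS hfg.mulOpposite)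
  · intro h S _ hS hfg
    refine (finite_quotient_greenL_iff MulOpposite.opEquiv fun _ _ => rfl).mpr
      (h Sᵐᵒᵖ ?_ hfg.mulOpposite)
    refine hV.of_identities hS fun u v huv => ?_
    exact huv.of_injective (⟨fun x => x.unop.unop, fun _ _ => rfl⟩ : Sᵐᵒᵖᵐᵒᵖ →ₙ* S)
      (MulOpposite.unop_injective.comp MulOpposite.unop_injective)

theorem isLocallyLFinite_iff {V : (S : Type u) → [Semigroup S] → Prop}
    (hV : IsSemigroupVariety V)
    (hpcr : ∀ (S : Type u) [Semigroup S], V S → IsPeriodicSemigroup S ∧ IsCompletelyRegular S) :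
    IsLocallyLFinite V ↔ ∀ (G : Type u) [Group G], IsNovikovAdian G → ¬ V (RSemigroup G) := by
  have hdual : ∀ (S : Type u) [Semigroup S], V Sᵐᵒᵖ →
      IsPeriodicSemigroup S ∧ IsCompletelyRegular S := fun S _ hS =>
    ⟨(hpcr Sᵐᵒᵖ hS).1.of_mulOpposite, (hpcr Sᵐᵒᵖ hS).2.of_mulOpposite⟩
  rw [isLocallyLFinite_iff_mulOpposite hV, isLocallyRFinite_iff hV.mulOpposite hdual]
  refine forall_congr' fun G => forall_congr' fun _ => imp_congr_right fun _ => not_congr ?_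
  exact ⟨fun h => hV.of_identities h fun _ _ => (satisfiesIdentity_RSemigroup_iff G).mpr,
    fun h => hV.of_identities h fun _ _ => (satisfiesIdentity_RSemigroup_iff G).mp⟩

lemma isLocallyHFinite_iff {V : (S : Type u) → [Semigroup S] → Prop} :
    IsLocallyHFinite V ↔ IsLocallyRFinite V ∧ IsLocallyLFinite V := by
  simp only [IsLocallyHFinite, IsLocallyRFinite, IsLocallyLFinite, finite_quotient_greenH_iff]
  exact ⟨fun h => ⟨fun S _ hS hfg => (h S hS hfg).1, fun S _ hS hfg => (h S hS hfg).2⟩,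
    fun h S _ hS hfg => ⟨h.1 S hS hfg, h.2 S hS hfg⟩⟩

theorem mainTheorem4 (V : (S : Type u) → [Semigroup S] → Prop)
    (hV : IsSemigroupVariety V)
    (hpcr : ∀ (S : Type u) [Semigroup S], V S → IsPeriodicSemigroup S ∧ IsCompletelyRegular S) :
    (IsLocallyRFinite V ↔
      ∀ (G : Type u) [Group G], IsNovikovAdian G → ¬ V (LSemigroup G)) ∧
    (IsLocallyLFinite V ↔
      ∀ (G : Type u) [Group G], IsNovikovAdian G → ¬ V (RSemigroup G)) ∧
    (IsLocallyHFinite V ↔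
      ∀ (G : Type u) [Group G], IsNovikovAdian G → ¬ V (LSemigroup G) ∧ ¬ V (RSemigroup G)) := by
  refine ⟨isLocallyRFinite_iff hV hpcr, isLocallyLFinite_iff hV hpcr, ?_⟩
  rw [isLocallyHFinite_iff, isLocallyRFinite_iff hV hpcr, isLocallyLFinite_iff hV hpcr]
  exact ⟨fun h G _ hG => ⟨h.1 G hG, h.2 G hG⟩,
    fun h => ⟨fun G _ hG => (h G hG).1, fun G _ hG => (h G hG).2⟩⟩
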